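/- **Model.** A line network has nodes $0,1,\dots,L$ ($L\ge 1$) joined in tandem by links $1,\dots,L$. In every time slot $t=1,2,\dots$ there is one packet transmission over every link; transmissions over link $i$ succeed independently with probability $p_i\in(0,1]$, independently over links and slots, and there is no feedback. The source (node $0$) holds $k=q\alpha$ message vectors over $\mathbb F_2$, divided into $q$ disjoint chunks of $\alpha$ vectors each. For every transmission the transmitting node chooses one of the $q$ chunks uniformly at random, independently of everything else. The source then sends a uniformly random $\mathbb F_2$-linear combination of the message vectors of that chunk; every other node sends a uniformly random $\mathbb F_2$-linear combination of the packets of that chunk which it has received in earlier slots. The sink (node $L$) can decode a chunk once it has received $\alpha$ packets of this chunk whose global encoding vectors in $\mathbb F_2^\alpha$ are linearly independent. The *coding delay* is the first time $N$ such that the sink can decode all $q$ chunks from the packets received in the first $N$ slots; it is a random variable in $\mathbb N\cup\{\infty\}$, depending on the losses and on the code. Put $$p=\min_{1\le i\le L}p_i,\qquad \gamma_e=\min_{1<i\le L}|p_i-p_{i-1}|,$$ with $\gamma_e=\infty$ if $L=1$. Let $\log$ be the logarithm to any fixed base $b>1$. **Theorem.** Consider a sequence of such networks and codes, indexed by $n\in\mathbb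 N$, where $L$, $q$, $\alpha$, $(p_i)_{1\le i\le L}$, the number $\epsilon\in(0,1)$ and the real number $w$ may all depend on $n$. Suppose that the parameters are unequal ($p_i\ne p_j$ for $i\neq j$) for every $n$ and that, as $n\to\infty$, $k\to\infty$, $$q=o\!\left(\min\Big\{\frac{\gamma_e}{p},1\Big\}\cdot\frac{k}{L\log(kL/\epsilon)}\right)\qquad\text{and}\qquad w\sim\left(\frac{kL^2}{q\log(kL/\epsilon)}\right)^{1/3}.$$ Then there is a sequence $\delta_n\to0$ such that for all sufficiently large $n$ the coding delay is larger than $$\frac1p\left(k+(1+\delta_n)\left(\frac{kL}{w}+\sqrt{k\,wq\log\frac{wqL}{\epsilon}}\right)\right)$$ with probability at most $\epsilon$. -/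

import Mathlib

open MeasureTheory ProbabilityTheory Filter Topology Asymptotics
open scoped ENNReal

/-- The data of a chunked code on a line network: `links` lossy links in tandem, joining the nodes
`0, …, links`; link `i` goes from node `i` to node `i + 1` and delivers each packet with probability
`success i`. The message of the source (node `0`) is split into `chunks` chunks of `chunkSize`
message vectors each. -/
structure ChunkedLine where
  links : ℕ
  links_pos : 0 < links
  success : Fin links → unitInterval
  success_pos : ∀ i, 0 < success i
  chunks : ℕ
  chunks_pos : 0 < chunks
  chunkSize : ℕ
  chunkSize_pos : 0 < chunkSize

namespace ChunkedLine

variable (S : ChunkedLine)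

instance : NeZero S.links := ⟨S.links_pos.ne'⟩

instance : NeZero S.chunks := ⟨S.chunks_pos.ne'⟩

/-- The number `k` of message vectors. -/
def messageSize : ℕ := S.chunks * S.chunkSize

/-- The smallest success probability `p`. -/
noncomputable def minSuccess : ℝ := ⨅ i, (S.success i : ℝ)

/-- The smallest gap `γₑ` between the success probabilities of two consecutive links
(`∞` if there is only one link). -/
noncomputable def minGap : ℝ≥0∞ :=
  ⨅ (i : Fin S.links) (j : Fin S.links) (_ : (j : ℕ) = i + 1),
    ENNReal.ofReal |(S.success j : ℝ) - S.success i|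

/-- The factor `min {γₑ / p, 1}`. -/
noncomputable def gapFactor : ℝ :=
  (min (S.minGap / ENNReal.ofReal S.minSuccess) 1).toReal

/-! ### The probability space

There is one transmission over every link in every time slot `t = 0, 1, 2, …`. -/

/-- The traffic: `T (i, t)` says whether the transmission over link `i` in slot `t` succeeds. -/
abbrev Traffic : Type := Fin S.links × ℕ → Bool

/-- The chunks: `C (i, t)` is the chunk chosen for the transmission over link `i` in slot `t`. -/
abbrev Choices : Type := Fin S.links × ℕ → Fin S.chunks

/-- The coefficients at the source: `A (t, j)` is the coefficient of the `j`-th message vector of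
the chosen chunk in the packet that the source transmits in slot `t`. -/
abbrev SourceCoeffs : Type := ℕ × Fin S.chunkSize → ZMod 2

/-- The coefficients at the relays: `B (i, t, s)` is the coefficient, in the packet transmitted over
link `i` in slot `t`, of the packet sent to the transmitting node in slot `s`. Only the entries with
`0 < i`, `s < t` and for a packet that was received and belongs to the chosen chunk are used. -/
abbrev RelayCoeffs : Type := Fin S.links × ℕ × ℕ → ZMod 2

/-- A sample point: the traffic, and the randomness of the code. -/
structure Sample where
  traffic : S.Traffic
  choice : S.Choices
  source : S.SourceCoeffs
  relay : S.RelayCoeffs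

/-- The samples as a product of the spaces of their components. -/
def ofProd (x : S.Traffic × S.Choices × S.SourceCoeffs × S.RelayCoeffs) : S.Sample :=
  ⟨x.1, x.2.1, x.2.2.1, x.2.2.2⟩

/-- The joint law: successes are independent and Bernoulli with the parameter of the link, chunks
are independent and uniform, coefficients are independent and uniform over `𝔽₂`, and these families
are independent of each other. -/
noncomputable def law :
    Measure (S.Traffic × S.Choices × S.SourceCoeffs × S.RelayCoeffs) :=
  (Measure.infinitePi fun x : Fin S.links × ℕ => bernoulliMeasure true false (S.success x.1)).prod
    ((Measure.infinitePi fun _ : Fin S.links × ℕ => uniformOn (Set.univ : Set (Fin S.chunks))).prod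
      ((Measure.infinitePi fun _ : ℕ × Fin S.chunkSize =>
          uniformOn (Set.univ : Set (ZMod 2))).prod
        (Measure.infinitePi fun _ : Fin S.links × ℕ × ℕ =>
          uniformOn (Set.univ : Set (ZMod 2)))))

variable {S}

namespace Sample

variable (ω : S.Sample)

/-- The transmission over link `i` in slot `t` succeeds and carries a packet of chunk `c`. -/
def Delivers (i : Fin S.links) (t : ℕ) (c : Fin S.chunks) : Prop :=
  ω.traffic (i, t) = true ∧ ω.choice (i, t) = c

open Classical in
/-- The global encoding vector, with respect to the message vectors of its chunk, of the packet
transmitted over link `i` in slot `t`: a uniformly random vector at the source, and a random linear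
combination of the packets of the chosen chunk received in earlier slots at a relay. -/
noncomputable def packet : (i : ℕ) → i < S.links → ℕ → (Fin S.chunkSize → ZMod 2)
  | 0, _, t => fun j => ω.source (t, j)
  | i + 1, h, t =>
      ∑ s ∈ Finset.range t,
        if ω.Delivers ⟨i, by omega⟩ s (ω.choice (⟨i + 1, h⟩, t)) then
          ω.relay (⟨i + 1, h⟩, t, s) • packet i (by omega) s
        else 0

/-- The last link, which leads to the sink. -/
def _root_.ChunkedLine.lastLink (S : ChunkedLine) : Fin S.links :=
  ⟨S.links - 1, Nat.sub_lt S.links_pos one_pos⟩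

/-- The global encoding vectors of the packets of chunk `c` that reach the sink by time `N`, that is
in the slots `0, …, N - 1`. -/
def received (c : Fin S.chunks) (N : ℕ) : Set (Fin S.chunkSize → ZMod 2) :=
  {v | ∃ t < N, ω.Delivers S.lastLink t c ∧ ω.packet S.lastLink S.lastLink.isLt t = v}

/-- By time `N` the sink can decode every chunk: it has received as many packets of the chunk with
linearly independent global encoding vectors as the chunk has message vectors. -/
def Decoded (N : ℕ) : Prop :=
  ∀ c : Fin S.chunks, (ω.received c N).finrank (ZMod 2) = S.chunkSize

/-- The coding delay: the first time at which the sink can decode all chunks (`∞` if there is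
none). -/
noncomputable def codingDelay : ℕ∞ :=
  ⨅ (N : ℕ) (_ : ω.Decoded N), (N : ℕ∞)

end Sample

/-- The probability that the coding delay is larger than `x`. -/
noncomputable def probDelayGT (S : ChunkedLine) (x : ℝ) : ℝ≥0∞ :=
  S.law {ω | ENNReal.ofReal x < ((S.ofProd ω).codingDelay : ℝ≥0∞)}

end ChunkedLine

/-! Fix a chunk and a nonzero vector `x`, and call a node infected once it has received a packet of
this chunk whose encoding vector is not orthogonal to `x`; the source is always infected. If the
sink cannot decode the chunk, its received vectors lie in a hyperplane, so for some `x` the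
infection has not reached it. Given the past, a packet of the chunk sent by the infected node at the
front has a fair random inner product with `x`. Hence, given losses and chunk choices, each arrival
over the link ahead of the front moves it with probability 1/2, and `measure_front_le` bounds its
law by `frontWeight`.

The union bound over `x` costs a factor `2 ^ α`. Averaging this bound directly would gain only about
`p / (2q)` per slot in the exponent against `α log 2`, so it would need about `2 log 2 · k / p`
slots. Instead the conditional bound is first raised to a small power `s = θ / log 2`: probabilities
only grow, powers below 1 are subadditive, the union bound now costs `exp (αθ)`, and each attempted
move has weight `exp (-θ)` for either outcome. Discounting position `h` by `d ^ h` with `d = θ²`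
makes the doubling of outcomes harmless, at the price `d⁻¹ ^ L`. Averaging over losses and choices
slot by slot gives `probDelayGT_le`: the failure probability is at most `q exp (αθ) θ ^ (-2L) exp
(-(p/q)(θ - 2θ²) N)`.

For `N ≈ (1 + 1/y) k / p` and `θ = 1 / (8y)` the net gain in the exponent is at least `k / (16 q
y²)`, up to rounding. With `y = w / L` the choice of `w` makes this of order `L y log (kL/ε)`. The
growth condition on `q` forces `y → ∞`, so the gain beats `log (q/ε) + 2L log (8y) + 1`. -/

/-! ### Resampling a coordinate of a product measure -/

/-- Replacing one coordinate by an independent copy preserves a product measure. -/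
theorem MeasureTheory.Measure.measurePreserving_update_infinitePi {ι : Type*} [DecidableEq ι]
    {X : ι → Type*} [∀ i, MeasurableSpace (X i)] (μ : ∀ i, Measure (X i))
    [∀ i, IsProbabilityMeasure (μ i)] (e : ι) :
    MeasurePreserving (fun z : (∀ i, X i) × X e => Function.update z.1 e z.2)
      ((Measure.infinitePi μ).prod (μ e)) (Measure.infinitePi μ) := by
  refine ⟨measurable_update', Measure.eq_infinitePi μ fun s t ht => ?_⟩
  rw [Measure.map_apply measurable_update' (.pi s.countable_toSet fun _ _ => ht _)]
  have key : (fun z : (∀ i, X i) × X e => Function.update z.1 e z.2) ⁻¹' (s : Set ι).pi t =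
      (((s.erase e : Finset ι) : Set ι).pi t) ×ˢ (if e ∈ s then t e else Set.univ) := by
    ext z
    simp only [Set.mem_preimage, Set.mem_pi, Finset.mem_coe, Set.mem_prod, Finset.mem_erase]
    constructor
    · intro h
      refine ⟨fun i hi => by simpa [hi.1] using h i hi.2, ?_⟩
      split_ifs with he
      · simpa using h e he
      · trivial
    · rintro ⟨h1, h2⟩ i hi
      by_cases hie : i = e
      · subst hie
        simpa [hi] using h2
      · simpa [hie] using h1 i ⟨hie, hi⟩
  rw [key, Measure.prod_prod, Measure.infinitePi_pi _ fun i _ => ht i]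
  split_ifs with he
  · rw [mul_comm, Finset.mul_prod_erase s (fun i => μ i (t i)) he]
  · rw [measure_univ, mul_one, Finset.erase_eq_of_notMem he]

theorem MeasureTheory.Measure.lintegral_infinitePi_eq_lintegral_update {ι : Type*}
    [DecidableEq ι] {X : ι → Type*} [∀ i, MeasurableSpace (X i)] (μ : ∀ i, Measure (X i))
    [∀ i, IsProbabilityMeasure (μ i)] (e : ι) {f : (∀ i, X i) → ℝ≥0∞} (hf : Measurable f) :
    ∫⁻ x, f x ∂Measure.infinitePi μ =
      ∫⁻ x, ∫⁻ y, f (Function.update x e y) ∂μ e ∂Measure.infinitePi μ := by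
  have h := Measure.measurePreserving_update_infinitePi μ e
  rw [← h.lintegral_comp hf]
  exact lintegral_prod _ (hf.comp h.measurable).aemeasurable

/-- A function that does not depend on a coordinate is independent of this coordinate. -/
theorem MeasureTheory.Measure.lintegral_infinitePi_mul_of_update_eq {ι : Type*}
    [DecidableEq ι] {X : ι → Type*} [∀ i, MeasurableSpace (X i)] (μ : ∀ i, Measure (X i))
    [∀ i, IsProbabilityMeasure (μ i)] (e : ι) {f : (∀ i, X i) → ℝ≥0∞} (hf : Measurable f)
    (hfe : ∀ x y, f (Function.update x e y) = f x) {g : X e → ℝ≥0∞} (hg : Measurable g) :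
    ∫⁻ x, f x * g (x e) ∂Measure.infinitePi μ =
      (∫⁻ x, f x ∂Measure.infinitePi μ) * ∫⁻ y, g y ∂μ e := by
  rw [Measure.lintegral_infinitePi_eq_lintegral_update μ e (by fun_prop),
    ← lintegral_mul_const _ hf]
  refine lintegral_congr fun x => ?_
  simp only [hfe, Function.update_self]
  rw [lintegral_const_mul _ hg]

theorem ProbabilityTheory.lintegral_uniformOn_univ {X : Type*} [Fintype X] [MeasurableSpace X]
    [MeasurableSingletonClass X] (f : X → ℝ≥0∞) :
    ∫⁻ x, f x ∂uniformOn (Set.univ : Set X) = (Fintype.card X : ℝ≥0∞)⁻¹ * ∑ x, f x := by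
  rw [uniformOn, cond, lintegral_smul_measure, Measure.restrict_univ, lintegral_count,
    tsum_fintype]
  simp [Measure.count_univ]

/-! ### The front of an infection that spreads along a line -/

open Classical in
/-- Let a front start at `0` and, in slot `t`, move from `h` to `h + 1` with probability `1 / 2` if
`A h t`, and stay otherwise. For `m = 1 / 2` this is the probability that the front is at `h` after
`t` slots; `m` is the weight of both outcomes of an attempted move. -/
noncomputable def frontWeight (A : ℕ → ℕ → Prop) (m : ℝ≥0∞) : ℕ → ℕ → ℝ≥0∞
  | 0, h => if h = 0 then 1 else 0
  | t + 1, 0 => frontWeight A m t 0 * (if A 0 t then m else 1)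
  | t + 1, h + 1 => frontWeight A m t (h + 1) * (if A (h + 1) t then m else 1) +
      frontWeight A m t h * (if A h t then m else 0)

-- Slots from `t` on do not enter the weight at time `t`; this is the source of its independence
-- from the losses and choices of slot `t`.
open Classical in
theorem frontWeight_congr {A A' : ℕ → ℕ → Prop} {m : ℝ≥0∞} {t : ℕ}
    (hA : ∀ h, ∀ s < t, (A h s ↔ A' h s)) (h : ℕ) :
    frontWeight A m t h = frontWeight A' m t h := by
  induction t generalizing h with
  | zero => simp [frontWeight]
  | succ t ih =>
    have ih' := ih fun h s hs => hA h s (by omega)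
    have hAt : ∀ h, A h t ↔ A' h t := fun h => hA h t (Nat.lt_succ_self t)
    cases h with
    | zero =>
      simp only [frontWeight, ih']
      congr 1
      exact if_congr (hAt 0) rfl rfl
    | succ h =>
      simp only [frontWeight, ih']
      congr 2
      · exact if_congr (hAt _) rfl rfl
      · exact if_congr (hAt _) rfl rfl

/-- For `0 < s ≤ 1` the power is multiplicative and subadditive, so it passes through the recursion
onto the single factors `m`. -/
theorem frontWeight_rpow_le (A : ℕ → ℕ → Prop) (m : ℝ≥0∞) {s : ℝ} (hs : 0 < s) (hs1 : s ≤ 1)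
    (t h : ℕ) : frontWeight A m t h ^ s ≤ frontWeight A (m ^ s) t h := by
  have h1 : ∀ P : Prop, [Decidable P] → (if P then m else 1) ^ s = if P then m ^ s else 1 := by
    intro P _; split_ifs <;> simp
  have h0 : ∀ P : Prop, [Decidable P] → (if P then m else 0) ^ s = if P then m ^ s else 0 := by
    intro P _; split_ifs <;> simp [hs]
  induction t generalizing h with
  | zero =>
    simp only [frontWeight]
    split_ifs <;> simp [hs]
  | succ t ih =>
    cases h with
    | zero =>
      simp only [frontWeight]
      rw [ENNReal.mul_rpow_of_nonneg _ _ hs.le, h1]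
      gcongr
      exact ih 0
    | succ h =>
      simp only [frontWeight]
      refine (ENNReal.rpow_add_le_add_rpow _ _ hs.le hs1).trans ?_
      rw [ENNReal.mul_rpow_of_nonneg _ _ hs.le, ENNReal.mul_rpow_of_nonneg _ _ hs.le, h1, h0]
      gcongr
      · exact ih (h + 1)
      · exact ih h

-- In the sum discounted by `c ^ h`, an arrival at the front splits the mass at `h` into `m` staying
-- and `m * c` moving on.
open Classical in
theorem sum_frontWeight_succ_le (A : ℕ → ℕ → Prop) (m c : ℝ≥0∞) (t n : ℕ) :
    ∑ h ∈ Finset.range n, frontWeight A m (t + 1) h * c ^ h ≤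
      ∑ h ∈ Finset.range n,
        frontWeight A m t h * c ^ h * (if A h t then m * (1 + c) else 1) := by
  have hsplit : ∀ h, frontWeight A m t h * c ^ h * (if A h t then m * (1 + c) else 1) =
      frontWeight A m t h * (if A h t then m else 1) * c ^ h +
        frontWeight A m t h * (if A h t then m else 0) * c ^ (h + 1) := by
    intro h
    split_ifs <;> ring
  simp_rw [hsplit]
  rw [Finset.sum_add_distrib]
  cases n with
  | zero => simp
  | succ n =>
    rw [Finset.sum_range_succ', Finset.sum_range_succ' (fun h =>
      frontWeight A m t h * (if A h t then m else 1) * c ^ h),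
      Finset.sum_range_succ (fun h => frontWeight A m t h * (if A h t then m else 0) * c ^ (h + 1))]
    simp only [frontWeight, add_mul, Finset.sum_add_distrib]
    rw [add_right_comm, ← add_assoc]
    -- The surplus on the right is the move from the last position out of the range.
    exact le_self_add

theorem frontWeight_sum_zero (A : ℕ → ℕ → Prop) (m c : ℝ≥0∞) (n : ℕ) :
    ∑ h ∈ Finset.range n, frontWeight A m 0 h * c ^ h ≤ 1 := by
  simp only [frontWeight, ite_mul, one_mul, zero_mul, Finset.sum_ite_eq']
  split_ifs <;> simp

/-! ### Averaging the front weights over losses and chunk choices -/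

namespace ChunkedLine

variable {S : ChunkedLine}

/-- A packet of chunk `c` arrives over link `h` in slot `t`. -/
def Arrives (T : S.Traffic) (C : S.Choices) (c : Fin S.chunks) (h t : ℕ) : Prop :=
  ∃ hh : h < S.links, T (⟨h, hh⟩, t) = true ∧ C (⟨h, hh⟩, t) = c

theorem measurableSet_arrives (c : Fin S.chunks) (h t : ℕ) :
    MeasurableSet {z : S.Traffic × S.Choices | Arrives z.1 z.2 c h t} := by
  by_cases hh : h < S.links
  · simp only [Arrives, hh, exists_true_left]
    exact (measurableSet_eq_fun (by fun_prop) measurable_const).inter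
      (measurableSet_eq_fun (by fun_prop) measurable_const)
  · simp [Arrives, hh]

theorem measurable_frontWeight_arrives (c : Fin S.chunks) (m : ℝ≥0∞) (t h : ℕ) :
    Measurable fun z : S.Traffic × S.Choices => frontWeight (Arrives z.1 z.2 c) m t h := by
  classical
  induction t generalizing h with
  | zero => simp only [frontWeight]; exact measurable_const
  | succ t ih =>
    have hm : ∀ h (a b : ℝ≥0∞), Measurable fun z : S.Traffic × S.Choices =>
        if Arrives z.1 z.2 c h t then a else b := fun h a b =>
      Measurable.ite (measurableSet_arrives c h t) measurable_const measurable_const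
    cases h with
    | zero =>
      simp only [frontWeight]
      exact (ih 0).mul (hm 0 m 1)
    | succ h =>
      simp only [frontWeight]
      exact ((ih (h + 1)).mul (hm (h + 1) m 1)).add ((ih h).mul (hm h m 0))

theorem frontWeight_arrives_update_traffic (T : S.Traffic) (C : S.Choices) (c : Fin S.chunks)
    (m : ℝ≥0∞) (t h : ℕ) (i : Fin S.links) (y : Bool) :
    frontWeight (Arrives (Function.update T (i, t) y) C c) m t h =
      frontWeight (Arrives T C c) m t h := by
  refine frontWeight_congr (fun h s hs => ?_) h
  simp [Arrives, Function.update, hs.ne]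

theorem frontWeight_arrives_update_choice (T : S.Traffic) (C : S.Choices) (c : Fin S.chunks)
    (m : ℝ≥0∞) (t h : ℕ) (i : Fin S.links) (y : Fin S.chunks) :
    frontWeight (Arrives T (Function.update C (i, t) y) c) m t h =
      frontWeight (Arrives T C c) m t h := by
  refine frontWeight_congr (fun h s hs => ?_) h
  simp [Arrives, Function.update, hs.ne]

variable (S) in
/-- The law of the traffic. -/
noncomputable def trafficLaw : Measure S.Traffic :=
  Measure.infinitePi fun x : Fin S.links × ℕ => bernoulliMeasure true false (S.success x.1)

variable (S) in
/-- The law of the chosen chunks. -/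
noncomputable def choiceLaw : Measure S.Choices :=
  Measure.infinitePi fun _ : Fin S.links × ℕ => uniformOn (Set.univ : Set (Fin S.chunks))

instance : IsProbabilityMeasure S.trafficLaw := by unfold trafficLaw; infer_instance

instance : IsProbabilityMeasure S.choiceLaw := by unfold choiceLaw; infer_instance

-- The weight at time `t` ignores slot `t`, so the factor for an arrival in this slot averages
-- independently: the packet gets through with the success probability of link `i`, and then carries
-- chunk `c` with probability `1 / q`.
open Classical in
theorem lintegral_frontWeight_mul_ite (c : Fin S.chunks) (m K : ℝ≥0∞) (t : ℕ) (i : Fin S.links) :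
    ∫⁻ T, ∫⁻ C, frontWeight (Arrives T C c) m t i * (if Arrives T C c i t then K else 1)
      ∂S.choiceLaw ∂S.trafficLaw =
    (∫⁻ T, ∫⁻ C, frontWeight (Arrives T C c) m t i ∂S.choiceLaw ∂S.trafficLaw) *
      (unitInterval.toNNReal (S.success i) * ((S.chunks : ℝ≥0∞)⁻¹ * (K + (S.chunks - 1 : ℕ))) +
        unitInterval.toNNReal (unitInterval.symm (S.success i))) := by
  have hmeas := measurable_frontWeight_arrives c m t (i : ℕ)
  have inner : ∀ T : S.Traffic, ∫⁻ C, frontWeight (Arrives T C c) m t i *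
      (if Arrives T C c i t then K else 1) ∂S.choiceLaw =
      (∫⁻ C, frontWeight (Arrives T C c) m t i ∂S.choiceLaw) *
        (fun b : Bool => if b then (S.chunks : ℝ≥0∞)⁻¹ * (K + (S.chunks - 1 : ℕ)) else 1)
          (T (i, t)) := by
    intro T
    have h1 := Measure.lintegral_infinitePi_mul_of_update_eq
      (fun _ : Fin S.links × ℕ => uniformOn (Set.univ : Set (Fin S.chunks))) (i, t)
      (f := fun C => frontWeight (Arrives T C c) m t i)
      (hmeas.comp measurable_prodMk_left)
      (fun C y => frontWeight_arrives_update_choice T C c m t i i y)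
      (g := fun y => if T (i, t) = true ∧ y = c then K else 1) (measurable_of_finite _)
    have h2 : ∀ C : S.Choices, Arrives T C c i t ↔ T (i, t) = true ∧ C (i, t) = c := by
      intro C; simp [Arrives]
    simp only [h2]
    refine h1.trans ?_
    congr 1
    rw [lintegral_uniformOn_univ]
    cases T (i, t) with
    | false =>
      simp only [Bool.false_eq_true, false_and, if_false, Finset.sum_const, Finset.card_univ,
        Fintype.card_fin, nsmul_eq_mul, mul_one]
      exact ENNReal.inv_mul_cancel (by simp [S.chunks_pos.ne']) (by simp)
    | true =>
      simp only [true_and, if_true, Fintype.card_fin]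
      rw [← Finset.add_sum_erase _ _ (Finset.mem_univ c), if_pos rfl,
        Finset.sum_congr rfl (g := fun _ => (1 : ℝ≥0∞))
          (fun x hx => if_neg (Finset.ne_of_mem_erase hx))]
      simp [Finset.card_erase_of_mem]
  simp_rw [inner]
  have h3 := Measure.lintegral_infinitePi_mul_of_update_eq
    (fun x : Fin S.links × ℕ => bernoulliMeasure true false (S.success x.1)) (i, t)
    (f := fun T => ∫⁻ C, frontWeight (Arrives T C c) m t i ∂S.choiceLaw)
    hmeas.lintegral_prod_right'
    (fun T y => by simp only [frontWeight_arrives_update_traffic])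
    (g := fun b : Bool => if b then (S.chunks : ℝ≥0∞)⁻¹ * (K + (S.chunks - 1 : ℕ)) else 1)
    (measurable_of_finite _)
  refine h3.trans ?_
  congr 1
  rw [bernoulliMeasure_def, lintegral_add_measure, lintegral_smul_measure,
    lintegral_smul_measure, lintegral_dirac, lintegral_dirac]
  simp [ENNReal.smul_def]

/-- Each slot multiplies the discounted expected mass by at most `r`, wherever the front is; `r` is
a common bound for the mean factors of all links. -/
theorem lintegral_sum_frontWeight_le (c : Fin S.chunks) (m d r : ℝ≥0∞)
    (hr : ∀ i, unitInterval.toNNReal (S.success i) *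
      ((S.chunks : ℝ≥0∞)⁻¹ * (m * (1 + d) + (S.chunks - 1 : ℕ))) +
        unitInterval.toNNReal (unitInterval.symm (S.success i)) ≤ r) (t : ℕ) :
    ∫⁻ T, ∫⁻ C, ∑ h ∈ Finset.range S.links, frontWeight (Arrives T C c) m t h * d ^ h
      ∂S.choiceLaw ∂S.trafficLaw ≤ r ^ t := by
  classical
  have hmeas := fun t h => measurable_frontWeight_arrives c m t h
  have hswap : ∀ G : ℕ → S.Traffic × S.Choices → ℝ≥0∞, (∀ h, Measurable (G h)) →
      ∫⁻ T, ∫⁻ C, ∑ h ∈ Finset.range S.links, G h (T, C) * d ^ h ∂S.choiceLaw ∂S.trafficLaw =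
      ∑ h ∈ Finset.range S.links, (∫⁻ T, ∫⁻ C, G h (T, C) ∂S.choiceLaw ∂S.trafficLaw) * d ^ h := by
    intro G hG
    rw [← lintegral_prod (fun z => ∑ h ∈ Finset.range S.links, G h z * d ^ h)
      (by fun_prop), lintegral_finsetSum _ (by fun_prop)]
    refine Finset.sum_congr rfl fun h _ => ?_
    rw [lintegral_mul_const _ (hG h), lintegral_prod _ (hG h).aemeasurable]
  induction t with
  | zero =>
    rw [pow_zero]
    calc _ ≤ ∫⁻ T : S.Traffic, ∫⁻ C : S.Choices, 1 ∂S.choiceLaw ∂S.trafficLaw :=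
          lintegral_mono fun T => lintegral_mono fun C => frontWeight_sum_zero _ _ _ _
      _ = 1 := by simp
  | succ t ih =>
    calc _ ≤ ∫⁻ T, ∫⁻ C, ∑ h ∈ Finset.range S.links, (frontWeight (Arrives T C c) m t h *
            (if Arrives T C c h t then m * (1 + d) else 1)) * d ^ h
              ∂S.choiceLaw ∂S.trafficLaw := by
          refine lintegral_mono fun T => lintegral_mono fun C => ?_
          refine (sum_frontWeight_succ_le _ _ _ _ _).trans_eq ?_
          refine Finset.sum_congr rfl fun h _ => by ring
      _ = ∑ h ∈ Finset.range S.links, (∫⁻ T, ∫⁻ C, frontWeight (Arrives T C c) m t h *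
            (if Arrives T C c h t then m * (1 + d) else 1) ∂S.choiceLaw ∂S.trafficLaw) * d ^ h :=
          hswap (fun h z => frontWeight (Arrives z.1 z.2 c) m t h *
            (if Arrives z.1 z.2 c h t then m * (1 + d) else 1)) fun h => (hmeas t h).mul
              (Measurable.ite (measurableSet_arrives c h t) measurable_const measurable_const)
      _ ≤ ∑ h ∈ Finset.range S.links, ((∫⁻ T, ∫⁻ C, frontWeight (Arrives T C c) m t h
            ∂S.choiceLaw ∂S.trafficLaw) * d ^ h) * r := by
          refine Finset.sum_le_sum fun h hh => ?_
          have := lintegral_frontWeight_mul_ite c m (m * (1 + d)) t ⟨h, Finset.mem_range.1 hh⟩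
          simp only at this
          rw [this, mul_right_comm]
          gcongr
          exact hr _
      _ = (∫⁻ T, ∫⁻ C, ∑ h ∈ Finset.range S.links, frontWeight (Arrives T C c) m t h * d ^ h
            ∂S.choiceLaw ∂S.trafficLaw) * r := by
          rw [← Finset.sum_mul]
          congr 1
          exact (hswap (fun h z => frontWeight (Arrives z.1 z.2 c) m t h) (hmeas t)).symm
      _ ≤ r ^ t * r := by gcongr
      _ = r ^ (t + 1) := (pow_succ r t).symm

end ChunkedLine

/-- If a uniform coordinate determines `g` bijectively on an event not depending on this
coordinate, then `g` is uniform on the event. -/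
theorem MeasureTheory.Measure.infinitePi_uniformOn_inter_le {ι : Type*} [DecidableEq ι] (e : ι)
    {E : Set (ι → ZMod 2)} (hE : MeasurableSet E) {g : (ι → ZMod 2) → ZMod 2} (hg : Measurable g)
    (hEe : ∀ x y, Function.update x e y ∈ E ↔ x ∈ E)
    (hinj : ∀ x ∈ E, Function.Injective fun y => g (Function.update x e y)) (b : ZMod 2) :
    Measure.infinitePi (fun _ : ι => uniformOn (Set.univ : Set (ZMod 2))) (E ∩ g ⁻¹' {b}) ≤
      2⁻¹ * Measure.infinitePi (fun _ : ι => uniformOn (Set.univ : Set (ZMod 2))) E := by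
  classical
  have hEg : MeasurableSet (E ∩ g ⁻¹' {b}) := hE.inter (hg (measurableSet_singleton b))
  rw [← lintegral_indicator_one hEg, ← lintegral_indicator_one hE,
    Measure.lintegral_infinitePi_eq_lintegral_update _ e (measurable_one.indicator hEg),
    ← lintegral_const_mul _ (measurable_one.indicator hE)]
  refine lintegral_mono fun x => ?_
  rw [lintegral_uniformOn_univ, ZMod.card]
  by_cases hx : x ∈ E
  · have : ∀ y, (E ∩ g ⁻¹' {b}).indicator (1 : (ι → ZMod 2) → ℝ≥0∞) (Function.update x e y) =
        if g (Function.update x e y) = b then 1 else 0 := by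
      intro y
      simp [Set.indicator_apply, hEe, hx]
    simp only [this, Set.indicator_of_mem hx, Pi.one_apply, Finset.sum_boole]
    gcongr
    · simp
    · norm_cast
      refine Finset.card_le_one.2 fun y hy y' hy' => hinj x hx ?_
      simp only [Finset.mem_filter] at hy hy'
      exact hy.2.trans hy'.2.symm
  · have : ∀ y, (E ∩ g ⁻¹' {b}).indicator (1 : (ι → ZMod 2) → ℝ≥0∞) (Function.update x e y) =
        0 := by
      intro y
      simp [hEe, hx]
    simp [this]

/-! ### Infection with respect to a vector, and the motion of its front -/

namespace ChunkedLine

variable {S : ChunkedLine}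

variable (S) in
/-- The law of the coefficients at the source. -/
noncomputable def sourceLaw : Measure S.SourceCoeffs :=
  Measure.infinitePi fun _ : ℕ × Fin S.chunkSize => uniformOn (Set.univ : Set (ZMod 2))

variable (S) in
/-- The law of the coefficients at the relays. -/
noncomputable def relayLaw : Measure S.RelayCoeffs :=
  Measure.infinitePi fun _ : Fin S.links × ℕ × ℕ => uniformOn (Set.univ : Set (ZMod 2))

instance : IsProbabilityMeasure S.sourceLaw := by unfold sourceLaw; infer_instance

instance : IsProbabilityMeasure S.relayLaw := by unfold relayLaw; infer_instance

theorem law_eq : S.law = S.trafficLaw.prod (S.choiceLaw.prod (S.sourceLaw.prod S.relayLaw)) := rfl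

namespace Sample

/-- The inner product of `x` with the packet transmitted over link `h` in slot `t`. -/
noncomputable def bit (ω : S.Sample) (x : Fin S.chunkSize → ZMod 2) (h t : ℕ) : ZMod 2 :=
  if hh : h < S.links then x ⬝ᵥ ω.packet h hh t else 0

/-- Node `h` has received, in the first `t` slots, a packet of chunk `c` that is not orthogonal
to `x`. -/
def Infected (ω : S.Sample) (c : Fin S.chunks) (x : Fin S.chunkSize → ZMod 2) : ℕ → ℕ → Prop
  | 0, _ => True
  | h + 1, t => ∃ s < t, Arrives ω.traffic ω.choice c h s ∧ ω.bit x h s = 1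

/-- The front of the infection is at node `h` after `t` slots. -/
def Front (ω : S.Sample) (c : Fin S.chunks) (x : Fin S.chunkSize → ZMod 2) (h t : ℕ) : Prop :=
  ω.Infected c x h t ∧ ¬ω.Infected c x (h + 1) t

theorem measurable_packet (i : ℕ) (hi : i < S.links) (t : ℕ) :
    Measurable fun q => (S.ofProd q).packet i hi t := by
  classical
  induction i generalizing t with
  | zero =>
    simp only [packet, ofProd]
    fun_prop
  | succ i ih =>
    simp only [packet]
    refine Finset.measurable_fun_sum _ fun s _ => Measurable.ite ?_ ?_ measurable_const
    · simp only [Delivers, ofProd]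
      exact (measurableSet_eq_fun (by fun_prop) measurable_const).inter
        (measurableSet_eq_fun (by fun_prop) (by fun_prop))
    · refine measurable_pi_iff.2 fun j => ?_
      have h1 := measurable_pi_iff.1 (ih (by omega) s) j
      simp only [ofProd] at h1 ⊢
      simp only [Pi.smul_apply, smul_eq_mul]
      exact (Measurable.of_discrete (f := fun p : ZMod 2 × ZMod 2 => p.1 * p.2)).comp
        (Measurable.prodMk (by fun_prop) h1)

theorem measurable_bit (x : Fin S.chunkSize → ZMod 2) (h t : ℕ) :
    Measurable fun q => (S.ofProd q).bit x h t := by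
  by_cases hh : h < S.links
  · simp only [bit, hh, dite_true, dotProduct]
    have := measurable_pi_iff.1 (measurable_packet h hh t)
    fun_prop
  · simp only [bit, hh, dite_false]
    exact measurable_const

theorem measurableSet_infected (c : Fin S.chunks) (x : Fin S.chunkSize → ZMod 2) (h t : ℕ) :
    MeasurableSet {q | (S.ofProd q).Infected c x h t} := by
  cases h with
  | zero => simp [Infected]
  | succ h =>
    have : {q | (S.ofProd q).Infected c x (h + 1) t} = ⋃ s ∈ Finset.range t,
        {q | Arrives q.1 q.2.1 c h s} ∩ {q | (S.ofProd q).bit x h s = 1} := by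
      ext q
      simp only [Infected, ofProd, Set.mem_ofPred_eq, Finset.mem_range, Set.mem_iUnion,
        Set.mem_inter_iff, exists_prop]
    rw [this]
    refine Finset.measurableSet_biUnion _ fun s _ => MeasurableSet.inter ?_ ?_
    · exact (measurable_fst.prodMk (measurable_fst.comp measurable_snd))
        (measurableSet_arrives c h s)
    · exact measurable_bit x h s (measurableSet_singleton 1)

theorem measurableSet_front (c : Fin S.chunks) (x : Fin S.chunkSize → ZMod 2) (h t : ℕ) :
    MeasurableSet {q | (S.ofProd q).Front c x h t} :=
  (measurableSet_infected c x h t).inter (measurableSet_infected c x (h + 1) t).compl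

theorem bit_succ (ω : S.Sample) (x : Fin S.chunkSize → ZMod 2) {i t : ℕ} (hi : i + 1 < S.links) :
    ω.bit x (i + 1) t = ∑ s ∈ Finset.range t, open Classical in
      if Arrives ω.traffic ω.choice (ω.choice (⟨i + 1, hi⟩, t)) i s then
        ω.relay (⟨i + 1, hi⟩, t, s) * ω.bit x i s else 0 := by
  have hi' : i < S.links := by omega
  simp only [bit, hi, hi', dite_true, packet]
  rw [dotProduct_sum]
  refine Finset.sum_congr rfl fun s _ => ?_
  have hD : ω.Delivers ⟨i, hi'⟩ s (ω.choice (⟨i + 1, hi⟩, t)) ↔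
      Arrives ω.traffic ω.choice (ω.choice (⟨i + 1, hi⟩, t)) i s := by
    simp [Delivers, Arrives, hi']
  by_cases hA : Arrives ω.traffic ω.choice (ω.choice (⟨i + 1, hi⟩, t)) i s
  · rw [if_pos (hD.2 hA), if_pos hA, dotProduct_smul, smul_eq_mul]
  · rw [if_neg (mt hD.1 hA), if_neg hA, dotProduct_zero]

/-- Causality: what is sent before slot `t` uses only coefficients drawn before slot `t`, so
coefficients of slot `t` can be resampled without changing the past. -/
theorem bit_congr {ω ω' : S.Sample} {t : ℕ} (hT : ω.traffic = ω'.traffic)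
    (hC : ω.choice = ω'.choice) (hA : ∀ s < t, ∀ j, ω.source (s, j) = ω'.source (s, j))
    (hB : ∀ i, ∀ s < t, ∀ s', ω.relay (i, s, s') = ω'.relay (i, s, s'))
    (x : Fin S.chunkSize → ZMod 2) (h : ℕ) {s : ℕ} (hs : s < t) : ω.bit x h s = ω'.bit x h s := by
  induction h generalizing s with
  | zero => simp [bit, S.links_pos, packet, dotProduct, hA s hs]
  | succ h ih =>
    by_cases hh : h + 1 < S.links
    · rw [bit_succ _ _ hh, bit_succ _ _ hh, hT, hC]
      refine Finset.sum_congr rfl fun s' hs' => ?_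
      rw [hB _ s hs, ih ((Finset.mem_range.1 hs').trans hs)]
    · simp [bit, hh]

theorem infected_congr {ω ω' : S.Sample} {t : ℕ} (hT : ω.traffic = ω'.traffic)
    (hC : ω.choice = ω'.choice) (hA : ∀ s < t, ∀ j, ω.source (s, j) = ω'.source (s, j))
    (hB : ∀ i, ∀ s < t, ∀ s', ω.relay (i, s, s') = ω'.relay (i, s, s'))
    (c : Fin S.chunks) (x : Fin S.chunkSize → ZMod 2) (h : ℕ) {s : ℕ} (hs : s ≤ t) :
    ω.Infected c x h s ↔ ω'.Infected c x h s := by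
  cases h with
  | zero => simp [Infected]
  | succ h =>
    simp only [Infected, hT, hC]
    refine exists_congr fun s' => and_congr_right fun hs' => and_congr_right fun _ => ?_
    rw [bit_congr hT hC hA hB x h (hs'.trans_le hs)]

theorem front_congr {ω ω' : S.Sample} {t : ℕ} (hT : ω.traffic = ω'.traffic)
    (hC : ω.choice = ω'.choice) (hA : ∀ s < t, ∀ j, ω.source (s, j) = ω'.source (s, j))
    (hB : ∀ i, ∀ s < t, ∀ s', ω.relay (i, s, s') = ω'.relay (i, s, s'))
    (c : Fin S.chunks) (x : Fin S.chunkSize → ZMod 2) (h : ℕ) :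
    ω.Front c x h t ↔ ω'.Front c x h t := by
  unfold Front
  rw [infected_congr hT hC hA hB c x h le_rfl, infected_congr hT hC hA hB c x (h + 1) le_rfl]

/-- A packet of chunk `c` that is not orthogonal to `x` is sent by an infected node. -/
theorem infected_of_bit {ω : S.Sample} {c : Fin S.chunks} {x : Fin S.chunkSize → ZMod 2}
    {h t : ℕ} (hA : Arrives ω.traffic ω.choice c h t) (hb : ω.bit x h t = 1) :
    ω.Infected c x h t := by
  cases h with
  | zero => trivial
  | succ h =>
    obtain ⟨hh, -, hc⟩ := hA
    rw [bit_succ _ _ hh, hc] at hb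
    by_contra hcon
    refine zero_ne_one (Eq.trans (Finset.sum_eq_zero fun s hs => ?_).symm hb)
    split_ifs with hs'
    · have : ω.bit x h s ≠ 1 := fun hb' => hcon ⟨s, Finset.mem_range.1 hs, hs', hb'⟩
      have h01 : ∀ a : ZMod 2, a ≠ 1 → a = 0 := by decide
      rw [h01 _ this, mul_zero]
    · rfl

end Sample

open Sample

variable (T : S.Traffic) (C : S.Choices) (c : Fin S.chunks) (x : Fin S.chunkSize → ZMod 2)

/-- Resample the source coefficient of slot `t` at an index `j` with `x j ≠ 0`: it shifts the inner
product bijectively and does not affect the front at time `t`. -/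
theorem front_bit_source_le (hx : x ≠ 0) (t : ℕ) (b : ZMod 2) :
    (S.sourceLaw.prod S.relayLaw)
        {z | (S.ofProd (T, C, z)).Front c x 0 t ∧ (S.ofProd (T, C, z)).bit x 0 t = b} ≤
      2⁻¹ * (S.sourceLaw.prod S.relayLaw) {z | (S.ofProd (T, C, z)).Front c x 0 t} := by
  obtain ⟨j, hj⟩ := Function.ne_iff.1 hx
  have hm : Measurable fun z : S.SourceCoeffs × S.RelayCoeffs => (T, C, z) :=
    measurable_prodMk_left.comp measurable_prodMk_left
  have hF := hm (measurableSet_front c x 0 t)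
  have hb := (measurable_bit x 0 t).comp hm
  have hFb := hF.inter (hb (measurableSet_singleton b))
  refine (Measure.prod_apply_symm hFb).trans_le ?_
  rw [Measure.prod_apply_symm (by exact hF), ← lintegral_const_mul _
    (by exact measurable_measure_prodMk_right hF)]
  refine lintegral_mono fun B => ?_
  refine Measure.infinitePi_uniformOn_inter_le (t, j) (measurable_prodMk_right hF)
    (hb.comp measurable_prodMk_right) (fun A y => ?_) (fun A _ => ?_) b
  · refine front_congr (ω := S.ofProd (T, C, Function.update A (t, j) y, B))
      (ω' := S.ofProd (T, C, A, B)) rfl rfl (fun s hs j' => ?_) (fun _ _ _ _ => rfl) c x 0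
    simp [ofProd, Function.update, hs.ne]
  · intro y y' hy
    simp only [Function.comp_apply, bit, S.links_pos, dite_true, packet, dotProduct, ofProd] at hy
    rw [← Finset.add_sum_erase _ _ (Finset.mem_univ j),
      ← Finset.add_sum_erase _ _ (Finset.mem_univ j)] at hy
    have h1 : ∀ y : ZMod 2, ∑ j' ∈ Finset.univ.erase j,
        x j' * Function.update A (t, j) y (t, j') = ∑ j' ∈ Finset.univ.erase j, x j' * A (t, j') :=
      fun y => Finset.sum_congr rfl fun j' hj' => by
        simp [Function.update, Finset.ne_of_mem_erase hj']
    rw [h1, h1, add_left_inj, Function.update_self, Function.update_self] at hy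
    exact mul_left_cancel₀ hj hy

/-- Let `s` be the slot in which node `i + 1` was first infected. The packet of that slot has inner
product 1 with `x`, so its fresh coefficient in the packet of slot `t` makes the inner product
uniform. Since `s` is random, the event is split according to `s` before resampling. -/
theorem front_bit_relay_le {i t : ℕ} (hi : i + 1 < S.links) (hc : C (⟨i + 1, hi⟩, t) = c)
    (b : ZMod 2) :
    (S.sourceLaw.prod S.relayLaw)
        {z | (S.ofProd (T, C, z)).Front c x (i + 1) t ∧
          (S.ofProd (T, C, z)).bit x (i + 1) t = b} ≤
      2⁻¹ * (S.sourceLaw.prod S.relayLaw) {z | (S.ofProd (T, C, z)).Front c x (i + 1) t} := by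
  classical
  have hm : Measurable fun z : S.SourceCoeffs × S.RelayCoeffs => (T, C, z) :=
    measurable_prodMk_left.comp measurable_prodMk_left
  -- split according to the slot of the first infection of node `i + 1`
  set G : ℕ → Set (S.SourceCoeffs × S.RelayCoeffs) := fun s =>
    {z | (S.ofProd (T, C, z)).Front c x (i + 1) t ∧
      (S.ofProd (T, C, z)).Infected c x (i + 1) (s + 1) ∧
      ¬(S.ofProd (T, C, z)).Infected c x (i + 1) s} with hG
  have hGm : ∀ s, MeasurableSet (G s) := fun s =>
    (hm (measurableSet_front c x (i + 1) t)).inter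
      ((hm (measurableSet_infected c x (i + 1) (s + 1))).inter
        (hm (measurableSet_infected c x (i + 1) s)).compl)
  have hb := (measurable_bit x (i + 1) t).comp hm
  -- Infected by `s + 1` but not by `s`: the infecting packet is the one of slot `s`.
  have hlast : ∀ s, ∀ z ∈ G s, Arrives T C c i s ∧ (S.ofProd (T, C, z)).bit x i s = 1 := by
    rintro s z ⟨-, ⟨s', hs', hA⟩, h2⟩
    obtain rfl : s' = s := by
      by_contra hne
      exact h2 ⟨s', by omega, hA⟩
    exact hA
  have hdisj : Pairwise (Function.onFun Disjoint G) := by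
    intro s s' hss'
    refine Set.disjoint_left.2 fun z hz hz' => ?_
    rcases lt_or_gt_of_ne hss' with h | h
    · exact hz'.2.2 ⟨s, h, hlast s z hz⟩
    · exact hz.2.2 ⟨s', h, hlast s' z hz'⟩
  have hcover : {z | (S.ofProd (T, C, z)).Front c x (i + 1) t} = ⋃ s ∈ Finset.range t, G s := by
    ext z
    simp only [Set.mem_ofPred_eq, Set.mem_iUnion, Finset.mem_range, exists_prop]
    refine ⟨fun hz => ?_, fun ⟨s, _, hz⟩ => hz.1⟩
    have hex := hz.1
    refine ⟨Nat.find hex, (Nat.find_spec hex).1, hz,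
      ⟨Nat.find hex, Nat.lt_succ_self _, (Nat.find_spec hex).2⟩, ?_⟩
    rintro ⟨s, hs, hA⟩
    exact Nat.find_min hex hs ⟨hs.trans (Nat.find_spec hex).1, hA⟩
  have hhalf : ∀ s < t, (S.sourceLaw.prod S.relayLaw)
      (G s ∩ (fun z => (S.ofProd (T, C, z)).bit x (i + 1) t) ⁻¹' {b}) ≤
      2⁻¹ * (S.sourceLaw.prod S.relayLaw) (G s) := by
    intro s hs
    have hGb := (hGm s).inter (hb (measurableSet_singleton b))
    refine (Measure.prod_apply hGb).trans_le ?_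
    rw [Measure.prod_apply (hGm s), ← lintegral_const_mul _
      (measurable_measure_prodMk_left (hGm s))]
    refine lintegral_mono fun A => ?_
    have hcongr : ∀ (B : S.RelayCoeffs) (y : ZMod 2) (i' : Fin S.links), ∀ s' < t, ∀ s'',
        Function.update B (⟨i + 1, hi⟩, t, s) y (i', s', s'') = B (i', s', s'') := by
      intro B y i' s' hs' s''
      simp [Function.update, hs'.ne]
    refine Measure.infinitePi_uniformOn_inter_le (⟨i + 1, hi⟩, t, s)
      (measurable_prodMk_left (hGm s)) (hb.comp measurable_prodMk_left)
      (fun B y => ?_) (fun B hB => ?_) b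
    · have hinf : ∀ s' ≤ t, (S.ofProd (T, C, A, Function.update B (⟨i + 1, hi⟩, t, s) y)).Infected
          c x (i + 1) s' ↔ (S.ofProd (T, C, A, B)).Infected c x (i + 1) s' := fun s' hs' =>
        infected_congr (ω := S.ofProd (T, C, A, Function.update B (⟨i + 1, hi⟩, t, s) y))
          (ω' := S.ofProd (T, C, A, B)) rfl rfl (fun _ _ _ => rfl) (hcongr B y) c x (i + 1) hs'
      have hfront := front_congr (ω := S.ofProd (T, C, A, Function.update B (⟨i + 1, hi⟩, t, s) y))
        (ω' := S.ofProd (T, C, A, B)) rfl rfl (fun _ _ _ => rfl) (hcongr B y) c x (i + 1)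
      exact and_congr hfront (and_congr (hinf (s + 1) hs) (not_congr (hinf s hs.le)))
    · obtain ⟨hA1, hbit⟩ := hlast s _ hB
      intro y y' hy
      -- The resampled coefficient multiplies a bit equal to 1, so it enters as a plain summand.
      have hsum : ∀ y, (S.ofProd (T, C, A, Function.update B (⟨i + 1, hi⟩, t, s) y)).bit x
          (i + 1) t = y + ∑ s' ∈ (Finset.range t).erase s, if Arrives T C c i s' then
            B (⟨i + 1, hi⟩, t, s') * (S.ofProd (T, C, A, B)).bit x i s' else 0 := by
        intro y
        have hbits : ∀ s' < t, (S.ofProd (T, C, A, Function.update B (⟨i + 1, hi⟩, t, s) y)).bit x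
            i s' = (S.ofProd (T, C, A, B)).bit x i s' := fun s' hs' =>
          bit_congr (ω := S.ofProd (T, C, A, Function.update B (⟨i + 1, hi⟩, t, s) y))
            (ω' := S.ofProd (T, C, A, B)) rfl rfl (fun _ _ _ => rfl) (hcongr B y) x i hs'
        rw [bit_succ _ _ hi, ← Finset.add_sum_erase _ _ (Finset.mem_range.2 hs)]
        simp only [ofProd, hc, hA1, if_true, Function.update_self]
        have hb1 := hbits s hs
        simp only [ofProd] at hb1 hbit hbits
        rw [hb1, hbit, mul_one]
        congr 1
        refine Finset.sum_congr rfl fun s' hs' => ?_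
        rw [hbits s' (Finset.mem_range.1 (Finset.mem_of_mem_erase hs'))]
        simp [Function.update, Finset.ne_of_mem_erase hs']
      have hy' := (hsum y).symm.trans (Eq.trans hy (hsum y'))
      exact add_right_cancel hy'
  calc _ = (S.sourceLaw.prod S.relayLaw) (⋃ s ∈ Finset.range t,
          (G s ∩ (fun z => (S.ofProd (T, C, z)).bit x (i + 1) t) ⁻¹' {b})) := by
        rw [← Set.iUnion₂_inter, ← hcover]
        rfl
    _ ≤ ∑ s ∈ Finset.range t, (S.sourceLaw.prod S.relayLaw)
          (G s ∩ (fun z => (S.ofProd (T, C, z)).bit x (i + 1) t) ⁻¹' {b}) :=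
        measure_biUnion_finset_le _ _
    _ ≤ ∑ s ∈ Finset.range t, 2⁻¹ * (S.sourceLaw.prod S.relayLaw) (G s) :=
        Finset.sum_le_sum fun s hs => hhalf s (Finset.mem_range.1 hs)
    _ = _ := by
        rw [← Finset.mul_sum, hcover,
          measure_biUnion_finset (fun s _ s' _ h => hdisj h) fun s _ => hGm s]

theorem front_bit_le (hx : x ≠ 0) {h t : ℕ} (hA : Arrives T C c h t) (b : ZMod 2) :
    (S.sourceLaw.prod S.relayLaw)
        {z | (S.ofProd (T, C, z)).Front c x h t ∧ (S.ofProd (T, C, z)).bit x h t = b} ≤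
      2⁻¹ * (S.sourceLaw.prod S.relayLaw) {z | (S.ofProd (T, C, z)).Front c x h t} := by
  cases h with
  | zero => exact front_bit_source_le T C c x hx t b
  | succ i =>
    obtain ⟨hi, -, hc⟩ := hA
    exact front_bit_relay_le T C c x hi hc b

theorem front_succ_stay_le (hx : x ≠ 0) (h t : ℕ) : open Classical in
    (S.sourceLaw.prod S.relayLaw)
        {z | (S.ofProd (T, C, z)).Front c x h t ∧ (S.ofProd (T, C, z)).Front c x h (t + 1)} ≤
      (S.sourceLaw.prod S.relayLaw) {z | (S.ofProd (T, C, z)).Front c x h t} *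
        (if Arrives T C c h t then 2⁻¹ else 1) := by
  split_ifs with hA
  · rw [mul_comm]
    refine (measure_mono ?_).trans (front_bit_le T C c x hx hA 0)
    rintro z ⟨h1, h2⟩
    refine ⟨h1, ?_⟩
    by_contra h0
    have h01 : ∀ a : ZMod 2, a ≠ 0 → a = 1 := by decide
    exact h2.2 ⟨t, Nat.lt_succ_self t, hA, h01 _ h0⟩
  · rw [mul_one]
    exact measure_mono fun z hz => hz.1

/-- Only packets received in strictly earlier slots are combined, so the infection advances by at
most one node per slot. A front at `h + 1` thus either was there and stayed, or came from `h`; on an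
arrival each alternative has conditional probability at most 1/2. -/
theorem measure_front_le (hx : x ≠ 0) (t h : ℕ) :
    (S.sourceLaw.prod S.relayLaw) {z | (S.ofProd (T, C, z)).Front c x h t} ≤
      frontWeight (Arrives T C c) 2⁻¹ t h := by
  classical
  induction t generalizing h with
  | zero =>
    simp only [frontWeight]
    split_ifs with hh
    · exact prob_le_one
    · obtain ⟨h, rfl⟩ := Nat.exists_eq_succ_of_ne_zero hh
      simp [Front, Infected]
  | succ t ih =>
    have hnot : ∀ {h z}, ¬(S.ofProd (T, C, z)).Infected c x h (t + 1) →
        ¬(S.ofProd (T, C, z)).Infected c x h t := by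
      intro h z hn hi
      cases h with
      | zero => exact hn trivial
      | succ h =>
        obtain ⟨s, hs, hs'⟩ := hi
        exact hn ⟨s, by omega, hs'⟩
    cases h with
    | zero =>
      simp only [frontWeight]
      have hsub : {z | (S.ofProd (T, C, z)).Front c x 0 (t + 1)} ⊆
          {z | (S.ofProd (T, C, z)).Front c x 0 t ∧ (S.ofProd (T, C, z)).Front c x 0 (t + 1)} :=
        fun z hz => ⟨⟨trivial, hnot hz.2⟩, hz⟩
      refine (measure_mono hsub).trans ((front_succ_stay_le T C c x hx 0 t).trans ?_)
      gcongr
      exact ih 0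
    | succ h =>
      simp only [frontWeight]
      have hsub : {z | (S.ofProd (T, C, z)).Front c x (h + 1) (t + 1)} ⊆
          {z | (S.ofProd (T, C, z)).Front c x (h + 1) t ∧
            (S.ofProd (T, C, z)).Front c x (h + 1) (t + 1)} ∪
          {z | Arrives T C c h t ∧ (S.ofProd (T, C, z)).Front c x h t ∧
            (S.ofProd (T, C, z)).bit x h t = 1} := by
        intro z hz
        by_cases hi : (S.ofProd (T, C, z)).Infected c x (h + 1) t
        · exact Or.inl ⟨⟨hi, hnot hz.2⟩, hz⟩
        · obtain ⟨s, hs, hA, hb⟩ := hz.1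
          obtain rfl : s = t := by
            by_contra hne
            exact hi ⟨s, by omega, hA, hb⟩
          exact Or.inr ⟨hA, ⟨infected_of_bit hA hb, hi⟩, hb⟩
      refine (measure_mono hsub).trans ((measure_union_le _ _).trans ?_)
      gcongr
      · refine (front_succ_stay_le T C c x hx (h + 1) t).trans ?_
        gcongr
        exact ih (h + 1)
      · split_ifs with hA
        · simp only [hA, true_and]
          refine (front_bit_le T C c x hx hA 1).trans ?_
          rw [mul_comm]
          gcongr
          exact ih h
        · simp [hA]

end ChunkedLine

/-! ### From undecodable chunks to an exponential bound on the delay -/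

namespace ChunkedLine

variable {S : ChunkedLine}

open Sample

/-- If the sink cannot decode chunk `c`, then all its packets of chunk `c` are orthogonal to some
nonzero `x`, so that the infection with respect to `x` has not reached the sink. -/
theorem exists_front_of_finrank_ne {ω : S.Sample} {c : Fin S.chunks} {N : ℕ}
    (h : (ω.received c N).finrank (ZMod 2) ≠ S.chunkSize) :
    ∃ x ≠ 0, ∃ i < S.links, ω.Front c x i N := by
  have hspan : Submodule.span (ZMod 2) (ω.received c N) < ⊤ := by
    refine lt_top_iff_ne_top.2 fun htop => h ?_
    rw [Set.finrank, htop, finrank_top, Module.finrank_fin_fun]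
  obtain ⟨f, hf0, hf⟩ := Submodule.exists_le_ker_of_lt_top _ hspan
  -- The functional vanishing on the received vectors is the inner product with its values on the
  -- standard basis.
  have hdot : ∀ v, (fun j => f (Pi.single j 1)) ⬝ᵥ v = f v := by
    intro v
    conv_rhs => rw [← Finset.univ_sum_single v]
    rw [map_sum, dotProduct]
    refine Finset.sum_congr rfl fun j _ => ?_
    rw [mul_comm, ← smul_eq_mul, ← map_smul, ← Pi.single_smul, smul_eq_mul, mul_one]
  refine ⟨fun j => f (Pi.single j 1), fun hx => hf0 ?_, ?_⟩
  · ext v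
    simp only [LinearMap.coe_comp, LinearMap.coe_single, Function.comp_apply, LinearMap.zero_apply]
    exact congrFun hx v
  -- Without a front before the sink, the infection passes from node to node up to the sink, which
  -- then holds a packet outside the hyperplane.
  · by_contra! hcon
    have hall : ∀ i ≤ S.links, ω.Infected c (fun j => f (Pi.single j 1)) i N := by
      intro i
      induction i with
      | zero => exact fun _ => trivial
      | succ i ih =>
        intro hi
        by_contra hn
        exact hcon i hi ⟨ih (by omega), hn⟩
    have hlast : ω.Infected c (fun j => f (Pi.single j 1)) (S.links - 1 + 1) N := by
      rw [Nat.sub_add_cancel S.links_pos]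
      exact hall _ le_rfl
    obtain ⟨t, ht, ⟨hh, hT, hC⟩, hb⟩ := hlast
    rw [bit, dif_pos hh, hdot] at hb
    have hmem : ω.packet (S.links - 1) hh t ∈ ω.received c N := ⟨t, ht, ⟨hT, hC⟩, rfl⟩
    have := hf (Submodule.subset_span hmem)
    rw [LinearMap.mem_ker, hb] at this
    exact one_ne_zero this

theorem measure_exists_front_le (T : S.Traffic) (C : S.Choices) (c : Fin S.chunks) (N : ℕ) :
    (S.sourceLaw.prod S.relayLaw)
      {z | ∃ x ≠ 0, ∃ i < S.links, (S.ofProd (T, C, z)).Front c x i N} ≤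
      2 ^ S.chunkSize * ∑ h ∈ Finset.range S.links, frontWeight (Arrives T C c) 2⁻¹ N h := by
  classical
  have hsub : {z | ∃ x ≠ 0, ∃ i < S.links, (S.ofProd (T, C, z)).Front c x i N} =
      ⋃ x ∈ Finset.univ.erase (0 : Fin S.chunkSize → ZMod 2), ⋃ h ∈ Finset.range S.links,
        {z | (S.ofProd (T, C, z)).Front c x h N} := by
    ext z
    simp
  rw [hsub]
  calc _ ≤ ∑ x ∈ Finset.univ.erase (0 : Fin S.chunkSize → ZMod 2),
        ∑ h ∈ Finset.range S.links, frontWeight (Arrives T C c) 2⁻¹ N h := by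
        refine (measure_biUnion_finset_le _ _).trans (Finset.sum_le_sum fun x hx => ?_)
        refine (measure_biUnion_finset_le _ _).trans (Finset.sum_le_sum fun h _ => ?_)
        exact measure_front_le T C c x (Finset.ne_of_mem_erase hx) N h
    _ ≤ _ := by
        rw [Finset.sum_const, nsmul_eq_mul]
        gcongr
        have hcard : (Finset.univ.erase (0 : Fin S.chunkSize → ZMod 2)).card ≤ 2 ^ S.chunkSize := by
          refine (Finset.card_le_card (Finset.erase_subset _ _)).trans_eq ?_
          simp [ZMod.card]
        exact_mod_cast hcard

/-- A probability is at most its `s`-th power for `s ≤ 1`. The power is taken before averaging over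
losses and choices; a small `s` then keeps rare bad traffic from dominating the mean. -/
theorem measure_exists_front_le_rpow (T : S.Traffic) (C : S.Choices) (c : Fin S.chunks) (N : ℕ)
    {s : ℝ} (hs : 0 < s) (hs1 : s ≤ 1) :
    (S.sourceLaw.prod S.relayLaw)
      {z | ∃ x ≠ 0, ∃ i < S.links, (S.ofProd (T, C, z)).Front c x i N} ≤
      (2 ^ S.chunkSize) ^ s *
        ∑ h ∈ Finset.range S.links, frontWeight (Arrives T C c) (2⁻¹ ^ s) N h := by
  have hsum : ∀ (u : Finset ℕ) (f : ℕ → ℝ≥0∞), (∑ h ∈ u, f h) ^ s ≤ ∑ h ∈ u, f h ^ s := by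
    intro u f
    exact Finset.le_sum_of_subadditive (fun a : ℝ≥0∞ => a ^ s) (by simp [hs])
      (fun a b => ENNReal.rpow_add_le_add_rpow a b hs.le hs1) u f
  calc _ ≤ ((S.sourceLaw.prod S.relayLaw)
        {z | ∃ x ≠ 0, ∃ i < S.links, (S.ofProd (T, C, z)).Front c x i N}) ^ s :=
        (ENNReal.rpow_one _).symm.trans_le
          (ENNReal.rpow_le_rpow_of_exponent_ge prob_le_one hs1)
    _ ≤ (2 ^ S.chunkSize *
          ∑ h ∈ Finset.range S.links, frontWeight (Arrives T C c) 2⁻¹ N h) ^ s := by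
        gcongr
        exact measure_exists_front_le T C c N
    _ ≤ _ := by
        rw [ENNReal.mul_rpow_of_nonneg _ _ hs.le]
        gcongr
        exact (hsum _ _).trans
          (Finset.sum_le_sum fun h _ => frontWeight_rpow_le _ _ hs hs1 N h)

theorem law_exists_front_le (c : Fin S.chunks) (N : ℕ) {s : ℝ} (hs : 0 < s) (hs1 : s ≤ 1)
    {d r : ℝ≥0∞} (hd0 : d ≠ 0) (hd1 : d ≤ 1)
    (hr : ∀ i, unitInterval.toNNReal (S.success i) *
      ((S.chunks : ℝ≥0∞)⁻¹ * (2⁻¹ ^ s * (1 + d) + (S.chunks - 1 : ℕ))) +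
        unitInterval.toNNReal (unitInterval.symm (S.success i)) ≤ r) :
    S.law {q | ∃ x ≠ 0, ∃ i < S.links, (S.ofProd q).Front c x i N} ≤
      (2 ^ S.chunkSize) ^ s * (d⁻¹ ^ S.links * r ^ N) := by
  classical
  have hU : MeasurableSet {q | ∃ x ≠ 0, ∃ i < S.links, (S.ofProd q).Front c x i N} := by
    have : {q | ∃ x ≠ 0, ∃ i < S.links, (S.ofProd q).Front c x i N} =
        ⋃ x ∈ Finset.univ.erase (0 : Fin S.chunkSize → ZMod 2), ⋃ h ∈ Finset.range S.links,
          {q | (S.ofProd q).Front c x h N} := by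
      ext q
      simp
    rw [this]
    exact Finset.measurableSet_biUnion _ fun x _ => Finset.measurableSet_biUnion _ fun h _ =>
      measurableSet_front c x h N
  have hd_top : d ≠ ⊤ := (hd1.trans_lt ENNReal.one_lt_top).ne
  rw [law_eq, Measure.prod_apply hU]
  calc _ = ∫⁻ T, ∫⁻ C, (S.sourceLaw.prod S.relayLaw)
        {z | ∃ x ≠ 0, ∃ i < S.links, (S.ofProd (T, C, z)).Front c x i N}
          ∂S.choiceLaw ∂S.trafficLaw :=
        lintegral_congr fun T => Measure.prod_apply (measurable_prodMk_left hU)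
    _ ≤ ∫⁻ T, ∫⁻ C, (2 ^ S.chunkSize) ^ s * (d⁻¹ ^ S.links *
          ∑ h ∈ Finset.range S.links, frontWeight (Arrives T C c) (2⁻¹ ^ s) N h * d ^ h)
            ∂S.choiceLaw ∂S.trafficLaw := by
        refine lintegral_mono fun T => lintegral_mono fun C => ?_
        refine (measure_exists_front_le_rpow T C c N hs hs1).trans ?_
        gcongr
        rw [Finset.mul_sum]
        refine Finset.sum_le_sum fun h hh => ?_
        -- The discount is undone at the cost `d⁻¹ ^ L`, which suffices because the front has not
        -- passed the last link.
        have hone : 1 ≤ d⁻¹ ^ S.links * d ^ h := by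
          calc (1 : ℝ≥0∞) = d⁻¹ ^ S.links * d ^ S.links := by
                rw [← mul_pow, ENNReal.inv_mul_cancel hd0 hd_top, one_pow]
            _ ≤ _ := mul_le_mul' le_rfl
                (pow_le_pow_right_of_le_one' hd1 (Finset.mem_range.1 hh).le)
        calc _ ≤ frontWeight (Arrives T C c) (2⁻¹ ^ s) N h * (d⁻¹ ^ S.links * d ^ h) :=
              le_mul_of_one_le_right' hone
          _ = _ := by ring
    _ = (2 ^ S.chunkSize) ^ s * (d⁻¹ ^ S.links * ∫⁻ T, ∫⁻ C,
          ∑ h ∈ Finset.range S.links, frontWeight (Arrives T C c) (2⁻¹ ^ s) N h * d ^ h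
            ∂S.choiceLaw ∂S.trafficLaw) := by
        have hmeas : Measurable fun z : S.Traffic × S.Choices =>
            ∑ h ∈ Finset.range S.links, frontWeight (Arrives z.1 z.2 c) (2⁻¹ ^ s) N h * d ^ h :=
          Finset.measurable_fun_sum _ fun h _ =>
            (measurable_frontWeight_arrives c _ N h).mul_const _
        simp_rw [← mul_assoc ((2 ^ S.chunkSize : ℝ≥0∞) ^ s)]
        rw [← lintegral_const_mul _ hmeas.lintegral_prod_right']
        exact lintegral_congr fun T =>
          lintegral_const_mul _ (hmeas.comp measurable_prodMk_left)
    _ ≤ _ := by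
        gcongr
        exact lintegral_sum_frontWeight_le c _ d r hr N

theorem minSuccess_le (i : Fin S.links) : S.minSuccess ≤ S.success i :=
  ciInf_le (Set.finite_range _).bddBelow i

theorem minSuccess_pos : 0 < S.minSuccess := by
  obtain ⟨i, hi⟩ := exists_eq_ciInf_of_finite (f := fun i => (S.success i : ℝ))
  rw [minSuccess, ← hi]
  exact S.success_pos i

theorem minSuccess_le_one : S.minSuccess ≤ 1 :=
  (minSuccess_le 0).trans (S.success 0).2.2

/-- A bound for the probability that the delay exceeds `y`, with a free parameter `θ`. -/
theorem probDelayGT_le {θ : ℝ} (hθ : 0 < θ) (hθ1 : θ ≤ 1 / 2) {y : ℝ} (hy : 0 ≤ y) :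
    S.probDelayGT y ≤ ENNReal.ofReal (S.chunks * (Real.exp (S.chunkSize * θ) *
      ((θ ^ 2)⁻¹ ^ S.links *
        Real.exp (-(S.minSuccess / S.chunks * (θ - 2 * θ ^ 2))) ^ ⌊y⌋₊))) := by
  set N := ⌊y⌋₊
  set r : ℝ := Real.exp (-(S.minSuccess / S.chunks * (θ - 2 * θ ^ 2))) with hr
  have hsub : {q | ENNReal.ofReal y < ((S.ofProd q).codingDelay : ℝ≥0∞)} ⊆
      ⋃ c : Fin S.chunks, {q | ∃ x ≠ 0, ∃ i < S.links, (S.ofProd q).Front c x i N} := by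
    intro q hq
    -- A delay above `y` means failure at the integer time `⌊y⌋`.
    have hdec : ¬(S.ofProd q).Decoded N := by
      intro hdec
      have h1 : (S.ofProd q).codingDelay ≤ (N : ℕ∞) := iInf₂_le N hdec
      have h2 : ((S.ofProd q).codingDelay : ℝ≥0∞) ≤ ((N : ℕ∞) : ℝ≥0∞) :=
        ENat.toENNReal_le.2 h1
      refine (hq.trans_le h2).not_ge ?_
      rw [ENat.toENNReal_coe, ← ENNReal.ofReal_natCast]
      exact ENNReal.ofReal_le_ofReal (Nat.floor_le hy)
    simp only [Decoded, not_forall] at hdec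
    obtain ⟨c, hc⟩ := hdec
    exact Set.mem_iUnion.2 ⟨c, exists_front_of_finrank_ne hc⟩
  have hlog : 0 < Real.log 2 := Real.log_pos one_lt_two
  -- The exponent `s = θ / log 2` turns `2⁻¹ ^ s` into `exp (-θ)`; it is at most 1 as `θ ≤ 1/2 < log
  -- 2`.
  have hs : 0 < θ / Real.log 2 := by positivity
  have hs1 : θ / Real.log 2 ≤ 1 := by
    rw [div_le_one hlog]
    linarith [Real.log_two_gt_d9]
  have hm : (2⁻¹ : ℝ≥0∞) ^ (θ / Real.log 2) = ENNReal.ofReal (Real.exp (-θ)) := by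
    have h2 : (2⁻¹ : ℝ≥0∞) = ENNReal.ofReal 2⁻¹ := by
      rw [ENNReal.ofReal_inv_of_pos two_pos, ENNReal.ofReal_ofNat]
    rw [h2, ENNReal.ofReal_rpow_of_pos (by positivity), Real.rpow_def_of_pos (by positivity),
      Real.log_inv]
    congr 2
    field_simp
  have hpow : ((2 : ℝ≥0∞) ^ S.chunkSize) ^ (θ / Real.log 2) =
      ENNReal.ofReal (Real.exp (S.chunkSize * θ)) := by
    rw [← ENNReal.ofReal_ofNat, ← ENNReal.ofReal_pow two_pos.le,
      ENNReal.ofReal_rpow_of_pos (by positivity), Real.rpow_def_of_pos (by positivity),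
      Real.log_pow]
    congr 2
    field_simp
  have hθ2 : 0 < θ ^ 2 := by positivity
  -- The discount `d = θ²` costs only second order here. The bound follows from `(1 + θ)(1 - θ +
  -- 2θ²) = 1 + θ² + 2θ³` and `1 + θ ≤ exp θ`.
  have hexp : Real.exp (-θ) * (1 + θ ^ 2) ≤ 1 - (θ - 2 * θ ^ 2) := by
    rw [Real.exp_neg, inv_mul_le_iff₀ (Real.exp_pos θ)]
    have h1 := Real.add_one_le_exp θ
    have h2 : 0 ≤ 1 - (θ - 2 * θ ^ 2) := by nlinarith
    nlinarith [mul_le_mul_of_nonneg_right h1 h2, pow_pos hθ 3]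
  have hq0 : (0 : ℝ) < S.chunks := Nat.cast_pos.2 S.chunks_pos
  have hrate : ∀ i, (unitInterval.toNNReal (S.success i) : ℝ≥0∞) *
      ((S.chunks : ℝ≥0∞)⁻¹ * (2⁻¹ ^ (θ / Real.log 2) * (1 + ENNReal.ofReal (θ ^ 2)) +
        (S.chunks - 1 : ℕ))) +
        unitInterval.toNNReal (unitInterval.symm (S.success i)) ≤ ENNReal.ofReal r := by
    intro i
    have hp0 : 0 ≤ (S.success i : ℝ) := (S.success i).2.1
    have hp1 : (S.success i : ℝ) ≤ 1 := (S.success i).2.2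
    have e1 : (unitInterval.toNNReal (S.success i) : ℝ≥0∞) = ENNReal.ofReal (S.success i) := by
      rw [ENNReal.ofReal, Real.toNNReal_of_nonneg hp0]; rfl
    have e2 : (unitInterval.toNNReal (unitInterval.symm (S.success i)) : ℝ≥0∞) =
        ENNReal.ofReal (1 - S.success i) := by
      rw [ENNReal.ofReal, Real.toNNReal_of_nonneg (by linarith)]; rfl
    have e3 : ((S.chunks : ℝ≥0∞))⁻¹ = ENNReal.ofReal (S.chunks : ℝ)⁻¹ := by
      rw [ENNReal.ofReal_inv_of_pos hq0, ENNReal.ofReal_natCast]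
    have e4 : ((S.chunks - 1 : ℕ) : ℝ≥0∞) = ENNReal.ofReal ((S.chunks : ℝ) - 1) := by
      rw [← ENNReal.ofReal_natCast, Nat.cast_pred S.chunks_pos]
    have hq1 : (0 : ℝ) ≤ (S.chunks : ℝ) - 1 := by
      rw [sub_nonneg]; exact_mod_cast S.chunks_pos
    rw [e1, e2, e3, e4, hm, ← ENNReal.ofReal_one, ← ENNReal.ofReal_add zero_le_one hθ2.le,
      ← ENNReal.ofReal_mul (Real.exp_pos _).le, ← ENNReal.ofReal_add (by positivity) hq1,
      ← ENNReal.ofReal_mul (by positivity), ← ENNReal.ofReal_mul hp0,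
      ← ENNReal.ofReal_add (by positivity) (by linarith)]
    refine ENNReal.ofReal_le_ofReal ?_
    have hgain : 0 ≤ θ - 2 * θ ^ 2 := by nlinarith
    calc _ ≤ (S.success i : ℝ) * ((S.chunks : ℝ)⁻¹ *
          ((1 - (θ - 2 * θ ^ 2)) + ((S.chunks : ℝ) - 1))) + (1 - S.success i) := by gcongr
      _ = 1 - S.success i / S.chunks * (θ - 2 * θ ^ 2) := by
          field_simp
          ring
      _ ≤ 1 - S.minSuccess / S.chunks * (θ - 2 * θ ^ 2) := by
          gcongr
          exact minSuccess_le i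
      _ ≤ r := by
          have := Real.add_one_le_exp (-(S.minSuccess / S.chunks * (θ - 2 * θ ^ 2)))
          linarith
  have hθ2_one : ENNReal.ofReal (θ ^ 2) ≤ 1 := by
    rw [← ENNReal.ofReal_one]
    exact ENNReal.ofReal_le_ofReal (by nlinarith)
  calc S.probDelayGT y ≤ ∑ c : Fin S.chunks,
        S.law {q | ∃ x ≠ 0, ∃ i < S.links, (S.ofProd q).Front c x i N} :=
        (measure_mono hsub).trans (measure_iUnion_fintype_le _ _)
    _ ≤ ∑ _c : Fin S.chunks, ENNReal.ofReal (Real.exp (S.chunkSize * θ)) *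
          ((ENNReal.ofReal (θ ^ 2))⁻¹ ^ S.links * ENNReal.ofReal r ^ N) := by
        refine Finset.sum_le_sum fun c _ => ?_
        rw [← hpow]
        exact law_exists_front_le c N hs hs1 (by simpa using hθ.ne') hθ2_one hrate
    _ = _ := by
        rw [Finset.sum_const, Finset.card_univ, Fintype.card_fin, nsmul_eq_mul,
          ← ENNReal.ofReal_inv_of_pos hθ2, ← ENNReal.ofReal_pow (by positivity),
          ← ENNReal.ofReal_pow (Real.exp_pos _).le, ← ENNReal.ofReal_mul (by positivity),
          ← ENNReal.ofReal_mul (by positivity), ← ENNReal.ofReal_natCast,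
          ← ENNReal.ofReal_mul (by positivity)]

end ChunkedLine

/-! ### Choice of `θ`, and the asymptotics -/

namespace ChunkedLine

variable {S : ChunkedLine}

theorem gapFactor_nonneg : 0 ≤ S.gapFactor := ENNReal.toReal_nonneg

theorem gapFactor_le_one : S.gapFactor ≤ 1 := by
  rw [gapFactor, ← ENNReal.toReal_one]
  exact ENNReal.toReal_mono ENNReal.one_ne_top (min_le_right _ _)

/-- With `(1 + 1 / y) k / p` slots the sink fails to decode with probability at most `ε`, if `y` is
not too large. -/
theorem probDelayGT_le_of_le {ε x y : ℝ} (hε : 0 < ε) (hy : 1 ≤ y)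
    (hx : S.messageSize + S.messageSize / y ≤ S.minSuccess * x)
    (hbound : Real.log (S.chunks / ε) + 2 * S.links * Real.log (8 * y) + 1 ≤
      S.messageSize / (16 * S.chunks * y ^ 2)) :
    S.probDelayGT x ≤ ENNReal.ofReal ε := by
  have hy0 : 0 < y := by linarith
  have hp0 : 0 < S.minSuccess := minSuccess_pos
  have hp1 : S.minSuccess ≤ 1 := minSuccess_le_one
  have hq1 : (1 : ℝ) ≤ S.chunks := by exact_mod_cast S.chunks_pos
  have hq0 : (0 : ℝ) < S.chunks := by linarith
  have hk : (S.messageSize : ℝ) = S.chunks * S.chunkSize := by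
    rw [messageSize]; push_cast; rfl
  have hα : (0 : ℝ) ≤ S.chunkSize := Nat.cast_nonneg _
  have hx0 : 0 ≤ x := by
    refine nonneg_of_mul_nonneg_right (le_trans ?_ hx) hp0
    positivity
  -- This `θ` maximizes `θ / y - 4θ²`, a lower bound for the net gain per message vector of a chunk,
  -- with value `1 / (16 y²)`.
  set θ : ℝ := 1 / (8 * y) with hθ
  have hθ0 : 0 < θ := by positivity
  have hθ1 : θ ≤ 1 / 8 := by
    rw [hθ]
    gcongr
    linarith
  refine (probDelayGT_le hθ0 (by linarith) hx0).trans (ENNReal.ofReal_le_ofReal ?_)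
  set g : ℝ := θ - 2 * θ ^ 2 with hg
  have hg0 : 0 ≤ g := by nlinarith
  have hg1 : g ≤ 1 := by nlinarith
  set N := ⌊x⌋₊
  have hN : x - 1 ≤ N := (Nat.sub_one_lt_floor x).le
  have hlogθ : Real.log ((θ ^ 2)⁻¹ ^ S.links) = 2 * S.links * Real.log (8 * y) := by
    rw [Real.log_pow, Real.log_inv, Real.log_pow, hθ, one_div, Real.log_inv]
    push_cast
    ring
  have hgain : S.messageSize / (16 * S.chunks * y ^ 2) ≤
      (S.chunkSize + S.chunkSize / y) * g - S.chunkSize * θ := by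
    have e1 : (S.messageSize : ℝ) / (16 * S.chunks * y ^ 2) = S.chunkSize * (θ / y - 4 * θ ^ 2) := by
      rw [hk, hθ]
      field_simp
      ring
    have e2 : (S.chunkSize + S.chunkSize / y) * g - S.chunkSize * θ =
        S.chunkSize * (θ / y - 2 * θ ^ 2 * (1 + 1 / y)) := by
      rw [hg]
      field_simp
      ring
    rw [e1, e2]
    have : 1 / y ≤ 1 := by rw [div_le_one hy0]; exact hy
    refine mul_le_mul_of_nonneg_left ?_ hα
    nlinarith [sq_nonneg θ]
  -- Rounding the number of slots down loses at most `(p/q) g ≤ 1`, which the summand 1 in `hbound`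
  -- pays for.
  have hslots : (S.chunkSize + S.chunkSize / y) * g - 1 ≤ N * (S.minSuccess / S.chunks * g) := by
    have h1 : (S.chunkSize : ℝ) + S.chunkSize / y ≤ S.minSuccess / S.chunks * x := by
      rw [div_mul_eq_mul_div, le_div_iff₀ hq0]
      refine le_trans (le_of_eq ?_) hx
      rw [hk]
      ring
    have h2 : S.minSuccess / S.chunks ≤ 1 := by
      rw [div_le_one hq0]; linarith
    have h3 : 0 ≤ S.minSuccess / S.chunks := by positivity
    calc (S.chunkSize + S.chunkSize / y) * g - 1
        ≤ S.minSuccess / S.chunks * x * g - S.minSuccess / S.chunks * g := by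
          have := mul_le_mul_of_nonneg_right h1 hg0
          have := mul_le_one₀ h2 hg0 hg1
          linarith
      _ = (x - 1) * (S.minSuccess / S.chunks * g) := by ring
      _ ≤ _ := by gcongr
  have hpos : (0 : ℝ) < (θ ^ 2)⁻¹ ^ S.links := by positivity
  rw [← Real.exp_nat_mul, ← Real.exp_log hpos, ← Real.exp_log hq0, ← Real.exp_add, ← Real.exp_add,
    ← Real.exp_add, Real.exp_log hq0, ← Real.le_log_iff_exp_le hε, hlogθ]
  rw [Real.log_div hq0.ne' hε.ne'] at hbound
  linarith

end ChunkedLine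

theorem mainTheorem9
    -- a sequence of line networks with chunked codes, in which all parameters may vary
    (S : ℕ → ChunkedLine) (ε w : ℕ → ℝ)
    -- the base of the logarithm
    (b : ℝ) (hb : 1 < b)
    (hε : ∀ n, 0 < ε n ∧ ε n < 1)
    -- no two links have equal parameters
    (hne : ∀ n, Function.Injective (S n).success)
    -- the message size tends to infinity
    (hk : Tendsto (fun n => (S n).messageSize) atTop atTop)
    (hq : (fun n => ((S n).chunks : ℝ)) =o[atTop] fun n =>
      (S n).gapFactor * ((S n).messageSize /
        ((S n).links * Real.logb b ((S n).messageSize * (S n).links / ε n))))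
    (hw : w ~[atTop] fun n =>
      ((S n).messageSize * ((S n).links : ℝ) ^ 2 /
        ((S n).chunks * Real.logb b ((S n).messageSize * (S n).links / ε n))) ^ (1 / 3 : ℝ)) :
    ∃ δ : ℕ → ℝ, Tendsto δ atTop (𝓝 0) ∧
      ∀ᶠ n in atTop,
        (S n).probDelayGT
          (1 / (S n).minSuccess * ((S n).messageSize + (1 + δ n) *
            ((S n).messageSize * (S n).links / w n +
              √((S n).messageSize * (w n * (S n).chunks *
                Real.logb b (w n * (S n).chunks * (S n).links / ε n)))))) ≤
        ENNReal.ofReal (ε n) := by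
  -- No correction is needed: the term `kL / w` alone provides enough extra slots.
  refine ⟨fun _ => 0, tendsto_const_nhds, ?_⟩
  have hlogb : 0 < Real.log b := Real.log_pos hb
  have hlog2 : 0 < Real.log 2 := Real.log_pos one_lt_two
  set ℓ : ℕ → ℝ := fun n => Real.logb b ((S n).messageSize * (S n).links / ε n) with hℓ
  set v : ℕ → ℝ := fun n =>
    ((S n).messageSize * ((S n).links : ℝ) ^ 2 / ((S n).chunks * ℓ n)) ^ (1 / 3 : ℝ) with hv
  have hL1 : ∀ n, (1 : ℝ) ≤ (S n).links := fun n => by exact_mod_cast (S n).links_pos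
  have hq1 : ∀ n, (1 : ℝ) ≤ (S n).chunks := fun n => by exact_mod_cast (S n).chunks_pos
  have hqk : ∀ n, ((S n).chunks : ℝ) ≤ (S n).messageSize := fun n => by
    exact_mod_cast Nat.le_mul_of_pos_right _ (S n).chunkSize_pos
  -- This is `log₂ (kL/ε) ≥ 1`: it makes `ℓ` positive and lets constants be absorbed into multiples
  -- of `ℓ`.
  have hbase : ∀ᶠ n in atTop, 1 ≤ Real.log b / Real.log 2 * ℓ n := by
    filter_upwards [hk.eventually_ge_atTop 2] with n hn
    have hk2 : (2 : ℝ) ≤ (S n).messageSize := by exact_mod_cast hn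
    have h1 : (2 : ℝ) ≤ (S n).messageSize * (S n).links / ε n := by
      rw [le_div_iff₀ (hε n).1]
      nlinarith [hL1 n, (hε n).1, (hε n).2]
    rw [hℓ]
    simp only [Real.logb]
    rw [div_mul_div_cancel₀' hlogb.ne', one_le_div hlog2]
    exact Real.log_le_log two_pos h1
  have hℓ0 : ∀ n, 1 ≤ Real.log b / Real.log 2 * ℓ n → 0 < ℓ n := fun n hn =>
    pos_of_mul_pos_right (by linarith) (div_pos hlogb hlog2).le
  have hv3 : ∀ n, 0 < ℓ n → 0 ≤ v n ∧
      v n ^ 3 * ((S n).chunks * ℓ n) = (S n).messageSize * ((S n).links : ℝ) ^ 2 := by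
    intro n hn
    have hq0 : (0 : ℝ) < (S n).chunks := by linarith [hq1 n]
    have h0 : 0 ≤ (S n).messageSize * ((S n).links : ℝ) ^ 2 / ((S n).chunks * ℓ n) := by positivity
    refine ⟨Real.rpow_nonneg h0 _, ?_⟩
    rw [hv]
    simp only
    rw [← Real.rpow_natCast, ← Real.rpow_mul h0]
    norm_num
    field_simp
  have hwv : ∀ᶠ n in atTop, |w n - v n| ≤ 1 / 2 * |v n| := by
    simpa using hw.isLittleO.def (show (0 : ℝ) < 1 / 2 by norm_num)
  -- The condition on `q` gives `8 M³ q L ℓ ≤ k`, that is `v ≥ 2ML`, and `w ≥ v / 2` eventually.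
  have hy : Tendsto (fun n => w n / (S n).links) atTop atTop := by
    refine tendsto_atTop.2 fun M₀ => ?_
    set M : ℝ := max M₀ 1
    have hM : 0 < M := lt_max_of_lt_right one_pos
    have hc : (0 : ℝ) < 1 / (8 * M ^ 3) := by positivity
    filter_upwards [hbase, hwv, hq.def hc] with n hn hwn hqn
    have hl := hℓ0 n hn
    obtain ⟨hvn, hvn3⟩ := hv3 n hl
    have hL0 : (0 : ℝ) < (S n).links := by linarith [hL1 n]
    have hq0 : (0 : ℝ) < (S n).chunks := by linarith [hq1 n]
    have hkl : 0 ≤ (S n).messageSize / ((S n).links * ℓ n) := by positivity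
    have h1 : ((S n).chunks : ℝ) * (8 * M ^ 3) ≤ (S n).messageSize / ((S n).links * ℓ n) := by
      rw [Real.norm_of_nonneg hq0.le, Real.norm_of_nonneg
        (mul_nonneg ChunkedLine.gapFactor_nonneg hkl), one_div, ← div_eq_inv_mul,
        le_div_iff₀ (by positivity)] at hqn
      exact hqn.trans (mul_le_of_le_one_left hkl ChunkedLine.gapFactor_le_one)
    rw [le_div_iff₀ (by positivity)] at h1
    have h2 : (2 * M * (S n).links) ^ 3 ≤ v n ^ 3 := by
      have hql : 0 < (S n).chunks * ℓ n := by positivity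
      refine le_of_mul_le_mul_right ?_ hql
      rw [hvn3]
      have := mul_le_mul_of_nonneg_right h1 (sq_nonneg ((S n).links : ℝ))
      linarith
    have h3 : 2 * M * (S n).links ≤ v n := le_of_pow_le_pow_left₀ three_ne_zero hvn h2
    rw [abs_of_nonneg hvn, abs_le] at hwn
    refine (le_max_left M₀ 1).trans ?_
    rw [le_div_iff₀ hL0]
    change M * _ ≤ _
    linarith [hwn.1]
  -- What remains of the comparison after division by `L ℓ`. The bound `y / 128` is shared equally
  -- between the logarithm and the constants.
  have hlarge : ∀ᶠ y : ℝ in atTop,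
      Real.log b + Real.log b / Real.log 2 * (2 * Real.log (8 * y) + 1) ≤ y / 128 := by
    set B := Real.log b / Real.log 2
    have hB : 0 < B := div_pos hlogb hlog2
    have h8 : Tendsto (fun y : ℝ => 8 * y) atTop atTop :=
      tendsto_id.const_mul_atTop (by norm_num)
    have hlo := h8.eventually (Real.isLittleO_log_id_atTop.def
      (show (0 : ℝ) < 1 / (8 * 512 * B) by positivity))
    filter_upwards [hlo, eventually_ge_atTop (256 * (Real.log b + B)), eventually_ge_atTop 1]
      with y h1 h2 h3
    rw [id, Real.norm_of_nonneg (by positivity : (0 : ℝ) ≤ 8 * y)] at h1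
    have h4 := mul_le_mul_of_nonneg_left ((le_abs_self _).trans h1) hB.le
    have h5 : B * (1 / (8 * 512 * B) * (8 * y)) = y / 512 := by
      field_simp
    rw [h5] at h4
    linarith
  filter_upwards [hbase, hwv, hy.eventually_ge_atTop 1, hy.eventually hlarge] with n hn hwn hyn hln
  have hl := hℓ0 n hn
  obtain ⟨hvn, hvn3⟩ := hv3 n hl
  have hL0 : (0 : ℝ) < (S n).links := by linarith [hL1 n]
  have hq0 : (0 : ℝ) < (S n).chunks := by linarith [hq1 n]
  have hk0 : (0 : ℝ) < (S n).messageSize := hq0.trans_le (hqk n)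
  have hε0 := (hε n).1
  have hp0 : 0 < (S n).minSuccess := ChunkedLine.minSuccess_pos
  have hw0 : 0 < w n := by
    have := (le_div_iff₀ hL0).1 hyn
    linarith
  set y := w n / (S n).links with hydef
  refine ChunkedLine.probDelayGT_le_of_le hε0 hyn ?_ ?_
  -- Here `kL / w = k / y`; the square root enters only through being nonnegative.
  · rw [← mul_assoc, mul_one_div_cancel hp0.ne', one_mul, add_zero, one_mul, hydef,
      div_div_eq_mul_div]
    linarith [Real.sqrt_nonneg ((S n).messageSize * (w n * (S n).chunks *
      Real.logb b (w n * (S n).chunks * (S n).links / ε n)))]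
  -- Here 128 is `16 · 8`, the factor 8 coming from `w³ ≤ (2v)³`.
  · have hmain : (S n).links * ℓ n * (y / 128) ≤
        (S n).messageSize / (16 * (S n).chunks * y ^ 2) := by
      rw [abs_of_nonneg hvn, abs_le] at hwn
      have hw2 : w n ≤ 2 * v n := by linarith [hwn.2]
      have hw3 : w n ^ 3 ≤ (2 * v n) ^ 3 := by gcongr
      rw [le_div_iff₀ (by positivity)]
      have e : (S n).links * ℓ n * (y / 128) * (16 * (S n).chunks * y ^ 2) * (S n).links ^ 2 =
          w n ^ 3 * ((S n).chunks * ℓ n) / 8 := by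
        rw [hydef]
        field_simp
        ring
      have hql : 0 < (S n).chunks * ℓ n := by positivity
      refine le_of_mul_le_mul_right ?_ (pow_pos hL0 2)
      rw [e, ← hvn3]
      have := mul_le_mul_of_nonneg_right hw3 hql.le
      linarith
    refine le_trans ?_ hmain
    have hlogq : Real.log ((S n).chunks / ε n) ≤ (S n).links * ℓ n * Real.log b := by
      have h1 : Real.log ((S n).chunks / ε n) ≤ ℓ n * Real.log b := by
        rw [hℓ]
        simp only [Real.logb]
        rw [div_mul_cancel₀ _ hlogb.ne']
        refine Real.log_le_log (by positivity) ?_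
        gcongr
        exact (hqk n).trans (le_mul_of_one_le_right hk0.le (hL1 n))
      refine h1.trans ?_
      gcongr
      exact le_mul_of_one_le_left hl.le (hL1 n)
    have hlog8 : 0 ≤ Real.log (8 * y) := Real.log_nonneg (by linarith)
    have hrest : 2 * (S n).links * Real.log (8 * y) + 1 ≤
        (S n).links * ℓ n * (Real.log b / Real.log 2 * (2 * Real.log (8 * y) + 1)) := by
      calc 2 * (S n).links * Real.log (8 * y) + 1
          ≤ (S n).links * (2 * Real.log (8 * y) + 1) := by linarith [hL1 n]
        _ ≤ (S n).links * (2 * Real.log (8 * y) + 1) * (Real.log b / Real.log 2 * ℓ n) :=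
            le_mul_of_one_le_right (by positivity) hn
        _ = _ := by ring
    have hscale := mul_le_mul_of_nonneg_left hln (mul_pos hL0 hl).le
    linarith
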